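/- Consider a polling system with queues $Q_1,\dots,Q_N$ ($N\ge 1$) visited in cyclic order by one server. Type $j$ customers arrive according to independent Poisson processes with rates $\lambda_j\ge 0$; type $i$ service times have LST $\beta_i$; switch-over times $S_i$ follow the visits $V_i$; interarrival, service and switch-over times are independent. At the start of a visit $V_i$, each customer waiting in $Q_j$ independently stays with probability $q_j^{(V_i)}$ and otherwise leaves the system at once; likewise at the start of $S_i$, with probabilities $q_j^{(S_i)}$. Let $V_{ib}$ be the part of $V_i$ after this instantaneous reneging, and let $\mathit{LB}^{(V_{ib})}(z_1,\dots,z_N)=E\big[\prod_j z_j^{X_j}\big]$, where $X$ is the queue-length vector at the start of $V_{ib}$. The service discipline at $Q_i$ is of branching type if, whenever the server finds $k_i$ customers in $Q_i$ at the start of $V_{ib}$, each of these customers, in an i.i.d. manner, keeps the server at $Q_i$ for a random finite time and is replaced by a random population (with an arbitrary $N$-dimensional PGF $h_i$); the time and the population of one customer may be dependent, the visit time is the sum of the $k_i$ times, and customers in the other queues at the start of the visit stay. Let $\theta_i$ be the LST of the time that the server spends at $Q_i$ due to the presence of one customer there. (1) If the discipline at $Q_i$ is of branching type then, for an arbitrary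 law of the queue lengths at the beginning of the first cycle, in every cycle and for every $\omega\ge 0$, $$E\big[e^{-\omega V_i}\big]=\mathit{LB}^{(V_{ib})}(1,\dots,1,\theta_i(\omega),1,\dots,1),$$ where $\theta_i(\omega)$ is the $i$-th argument. In particular this holds in the stationary regime, when it exists. (2) Gated service at $Q_i$ (exactly the customers present at the start of $V_{ib}$ are served) is of branching type, and $\theta_i(\omega)=\beta_i(\omega)$ for $\omega\ge 0$. (3) If $\lambda_iE[B_i]<1$ (where $0\cdot\infty=0$), exhaustive service at $Q_i$ (customers are served until $Q_i$ is empty) is of branching type, and for each $\omega\ge 0$, $\theta_i(\omega)$ is the unique root $x\in(0,1]$ of $x=\beta_i\big(\omega+\lambda_i(1-x)\big)$. -/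

import Mathlib

open MeasureTheory ProbabilityTheory
open scoped NNReal ENNReal unitInterval

noncomputable section

namespace Polling

/-- A joint queue-length vector: the number of customers in each of the `N` queues. -/
abbrev Pop (N : ℕ) : Type := Fin N → ℕ

/-- Laplace-Stieltjes transform of a law on `[0, ∞)`. -/
def lst (μ : Measure ℝ≥0) (ω : ℝ) : ℝ := ∫ t, Real.exp (-(ω * (t : ℝ))) ∂μ

/-- Joint probability generating function of a law of queue-length vectors. -/
def pgf {N : ℕ} (μ : Measure (Pop N)) (z : Fin N → ℝ) : ℝ := ∫ x, ∏ j, z j ^ x j ∂μ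

lemma measurable_poissonMeasure : Measurable poissonMeasure := by
  refine Measure.measurable_of_measurable_coe _ fun s hs => ?_
  have h : ∀ r, poissonMeasure r s = ∑' n : ℕ, ENNReal.ofReal
      (Real.exp (-r) * r ^ n / (Nat.factorial n)) * (Measure.dirac n s) := by
    intro r
    simp [poissonMeasure, Measure.sum_apply _ hs]
  simp_rw [h]
  refine Measurable.tsum fun n => ?_
  fun_prop

/-- Poisson arrivals: given the length `t` of a period, the numbers of arrivals of the various
types during that period are independent, the number of type `j` arrivals being Poisson with
mean `rate j * t`. -/
def arrivals {N : ℕ} (rate : Fin N → ℝ≥0) : Kernel ℝ≥0 (Pop N) where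
  toFun t := Measure.pi fun j => poissonMeasure (rate j * t)
  measurable' := by
    refine Measure.measurable_of_measurable_coe _ fun s hs => ?_
    have h : ∀ t : ℝ≥0, (Measure.pi fun j => poissonMeasure (rate j * t)) s =
        ∑' x : s, ∏ j, poissonMeasure (rate j * t) {x.1 j} := by
      intro t
      rw [← Measure.tsum_indicator_apply_singleton _ s hs, ← tsum_subtype]
      simp only [Measure.pi_singleton]
    simp_rw [h]
    refine Measurable.tsum fun x => Finset.measurable_prod _ fun j _ => ?_
    exact (Measure.measurable_coe (measurableSet_singleton _)).comp
      (measurable_poissonMeasure.comp (measurable_const.mul measurable_id))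

instance {N : ℕ} (rate : Fin N → ℝ≥0) : IsMarkovKernel (arrivals rate) :=
  ⟨fun t => by
    change IsProbabilityMeasure (Measure.pi fun j => poissonMeasure (rate j * t))
    infer_instance⟩

/-- Synchronised reneging: independently of each other, each customer waiting in `Q_j` stays with
probability `q j` and leaves the system with probability `1 - q j`. -/
def reneging {N : ℕ} (q : Fin N → I) : Kernel (Pop N) (Pop N) :=
  Kernel.ofFunOfCountable fun k => Measure.pi fun j => binomial (k j) (q j)

/-- A cyclic polling system with queues `Q_i`, `i : Fin N`, switch-over times, Poisson arrivals
and synchronised reneging at polling instants. -/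
structure PollingModel (N : ℕ) where
  /-- arrival rates of the customer types -/
  rate : Fin N → ℝ≥0
  /-- laws of the service times -/
  service : Fin N → ProbabilityMeasure ℝ≥0
  /-- laws of the switch-over times (from `Q_i` to its successor) -/
  switchover : Fin N → ProbabilityMeasure ℝ≥0
  /-- `stayV i j`: probability that a customer in `Q_j` stays at the start of a visit to `Q_i` -/
  stayV : Fin N → Fin N → I
  /-- `stayS i j`: probability that a customer in `Q_j` stays at the start of the `i`-th
  switch-over -/
  stayS : Fin N → Fin N → I
  /-- The service discipline of each queue, given through what it does to the system: the joint
  law of the duration of the visit to `Q_i` and the queue-length vector at its end, as a function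
  of the queue-length vector when the service starts. -/
  visit : (i : Fin N) → Kernel (Pop N) (ℝ≥0 × Pop N)
  /-- visits are a.s. finite -/
  visit_markov : ∀ i, IsMarkovKernel (visit i)

variable {N : ℕ}

/-! ### Branching-type disciplines -/

/-- The effect of a visit to `Q_i` in which each of the `k i` customers found there occupies the
server for some time and is replaced by some population; `y m` is the pair (time, population) of
the `m`-th of these customers. -/
def replaceAll (i : Fin N) (k : Pop N) (y : Fin (k i) → ℝ≥0 × Pop N) : ℝ≥0 × Pop N :=
  (∑ m, (y m).1, Function.update k i 0 + ∑ m, (y m).2)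

/-- Joint law of the time that the server spends at `Q_i` due to the presence of one customer
there, and of the population by which that customer is replaced: the outcome of a visit that finds
one customer in `Q_i` and none elsewhere. -/
def oneCustomerLaw (i : Fin N) (κ : Kernel (Pop N) (ℝ≥0 × Pop N)) : Measure (ℝ≥0 × Pop N) :=
  κ (Pi.single i 1)

/-- Branching property at `Q_i`: during a visit that finds `k i` customers in `Q_i`, each of these
customers occupies the server for a random time and is replaced by a random population, in an
i.i.d. manner. The population law (hence its generating function `h_i`) is arbitrary. -/
def IsBranching (i : Fin N) (κ : Kernel (Pop N) (ℝ≥0 × Pop N)) : Prop :=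
  ∀ k : Pop N, κ k =
    (Measure.pi fun _ : Fin (k i) => oneCustomerLaw i κ).map (replaceAll i k)

/-- `θ_i`: the LST of the time that the server spends at `Q_i` due to the presence of one
customer there. -/
def theta (i : Fin N) (κ : Kernel (Pop N) (ℝ≥0 × Pop N)) (ω : ℝ) : ℝ :=
  lst ((oneCustomerLaw i κ).map Prod.fst) ω

namespace PollingModel

/-! ### Gated and exhaustive service -/

/-- Joint law of one type `i` service time and the arrivals to all queues during that service. -/
def serviceLaw (M : PollingModel N) (i : Fin N) : Measure (ℝ≥0 × Pop N) :=
  (M.service i : Measure ℝ≥0) ⊗ₘ arrivals M.rate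

instance (M : PollingModel N) (i : Fin N) : IsProbabilityMeasure (M.serviceLaw i) := by
  unfold serviceLaw; infer_instance

/-- Duration and final queue-length vector of a visit to `Q_i` that starts from `k` and consists of
exactly `τ` consecutive services, where `ξ m` is the `m`-th service time together with the
arrivals during that service. -/
def afterServices (i : Fin N) (k : Pop N) (ξ : ℕ → ℝ≥0 × Pop N) (τ : ℕ) : ℝ≥0 × Pop N :=
  (∑ m ∈ Finset.range τ, (ξ m).1, k + ∑ m ∈ Finset.range τ, (ξ m).2 - Pi.single i τ)

/-- The number of services after which `Q_i` is empty for the first time, in a visit that starts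
with `k` (`0` if `Q_i` never gets empty). -/
def emptyingTime (i : Fin N) (k : Pop N) (ξ : ℕ → ℝ≥0 × Pop N) : ℕ :=
  sInf {n | k i + ∑ m ∈ Finset.range n, (ξ m).2 i = n}

/-- Gated service at `Q_i`: exactly the customers present at the start are served. -/
def gated (M : PollingModel N) (i : Fin N) : Kernel (Pop N) (ℝ≥0 × Pop N) :=
  Kernel.ofFunOfCountable fun k =>
    (Measure.infinitePi fun _ : ℕ => M.serviceLaw i).map fun ξ => afterServices i k ξ (k i)

/-- Exhaustive service at `Q_i`: customers are served until `Q_i` is empty. -/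
def exhaustive (M : PollingModel N) (i : Fin N) : Kernel (Pop N) (ℝ≥0 × Pop N) :=
  Kernel.ofFunOfCountable fun k =>
    (Measure.infinitePi fun _ : ℕ => M.serviceLaw i).map fun ξ =>
      afterServices i k ξ (emptyingTime i k ξ)

/-! ### Evolution of the system -/

/-- Evolution of the queue-length vector during `S_i` (after reneging): Poisson arrivals during
the switch-over time. -/
def switchStep (M : PollingModel N) (i : Fin N) : Kernel (Pop N) (Pop N) :=
  Kernel.ofFunOfCountable fun k =>
    (arrivals M.rate ∘ₘ (M.switchover i : Measure ℝ≥0)).map fun a => k + a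

/-- Evolution of the queue-length vector from the start of `V_{ia}` to the start of the next
queue's `a`-part: reneging at the start of the visit (`V_{ia}`), service (`V_{ib}`), reneging at the
start of the switch-over (`S_{ia}`), and arrivals during the switch-over (`S_{ib}`). -/
def step (M : PollingModel N) (i : Fin N) : Kernel (Pop N) (Pop N) :=
  M.switchStep i ∘ₖ reneging (M.stayS i) ∘ₖ (M.visit i).map Prod.snd ∘ₖ reneging (M.stayV i)

/-- Law of the queue-length vector at the start of the `m`-th visit (before reneging),
`m = 0, 1, 2, …`; the queues are visited in cyclic order, so this is a visit to the queue with
index `m` modulo `N`. The system starts with law `μ₀` at the start of a visit to the first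
queue. -/
def lawStart [NeZero N] (M : PollingModel N) (μ₀ : Measure (Pop N)) : ℕ → Measure (Pop N)
  | 0 => μ₀
  | m + 1 => M.step (Fin.ofNat N m) ∘ₘ lawStart M μ₀ m

/-- Law of the queue-length vector at the start of `V_{ia}` in cycle `n`. -/
def lawVa [NeZero N] (M : PollingModel N) (μ₀ : Measure (Pop N)) (n : ℕ) (i : Fin N) :
    Measure (Pop N) :=
  M.lawStart μ₀ (n * N + i)

/-- Law of the queue-length vector at the start of `V_{ib}` in cycle `n`. -/
def lawVb [NeZero N] (M : PollingModel N) (μ₀ : Measure (Pop N)) (n : ℕ) (i : Fin N) :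
    Measure (Pop N) :=
  reneging (M.stayV i) ∘ₘ M.lawVa μ₀ n i

/-- Law of the visit time `V_i` in cycle `n`. -/
def lawVisitTime [NeZero N] (M : PollingModel N) (μ₀ : Measure (Pop N)) (n : ℕ) (i : Fin N) :
    Measure ℝ≥0 :=
  (M.visit i ∘ₘ M.lawVb μ₀ n i).map Prod.fst

end PollingModel

end Polling

end

/-! Conditionally on the queue lengths `k` at the start of the service, branching makes the visit
time a sum of `k i` i.i.d. times, so its transform is `θ_i(ω) ^ k i`; averaging over `k` gives the
generating function with all other arguments equal to one (`lst_visit`). The earlier evolution of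
the system enters only through the fact that the law of `k` is a probability measure, which is why
the initial law is arbitrary.

Gated service is branching because each customer contributes one service and the arrivals during it.

For exhaustive service, the services form an i.i.d. sequence, and the queue shrinks by at most one
per service. A load below one makes it empty a.s., by the strong law (`ae_nonempty_emptyInstants`).
Clearing `c + 1` customers amounts to clearing one of them with all its descendants and then the
other `c`. The first of these ends at a stopping time, after which the sequence starts afresh
(`map_splice_stopping`), so the law for `c` customers is a `c`-fold convolution
(`IsStable.clearanceLaw_eq_iidSum`).

Restarting after the first service instead gives `θ = E[exp(-ωB) θ^A]`, where `A` counts the type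
`i` arrivals during `B`; the Poisson generating function turns this into the busy-period equation.
Its root is unique because the right-hand side is Lipschitz in `x` with constant `λ_i E[B_i] < 1`.
-/

namespace Polling

/-! ### Regeneration of i.i.d. sequences at fixed and stopping times -/

section Splice

variable {α : Type*}

/-- The sequence that follows `ξ` for the first `n` terms and then runs through `η`. -/
def splice (n : ℕ) (ξ η : ℕ → α) : ℕ → α := fun m => if m < n then ξ m else η (m - n)

lemma splice_of_lt {n m : ℕ} (h : m < n) (ξ η : ℕ → α) : splice n ξ η m = ξ m := if_pos h

lemma splice_add (n m : ℕ) (ξ η : ℕ → α) : splice n ξ η (n + m) = η m := by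
  simp [splice]

lemma comp_splice {β : Type*} (f : α → β) (n : ℕ) (ξ η : ℕ → α) :
    (fun m => f (splice n ξ η m)) = splice n (fun m => f (ξ m)) (fun m => f (η m)) := by
  funext m
  simp only [splice]
  split_ifs <;> rfl

lemma sum_splice_of_le [AddCommMonoid α] {n q : ℕ} (h : q ≤ n) (ξ η : ℕ → α) :
    ∑ m ∈ Finset.range q, splice n ξ η m = ∑ m ∈ Finset.range q, ξ m :=
  Finset.sum_congr rfl fun _ hm =>
    splice_of_lt (lt_of_lt_of_le (Finset.mem_range.mp hm) h) ξ η

lemma sum_splice_add [AddCommMonoid α] (n p : ℕ) (ξ η : ℕ → α) :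
    ∑ m ∈ Finset.range (n + p), splice n ξ η m =
      ∑ m ∈ Finset.range n, ξ m + ∑ m ∈ Finset.range p, η m := by
  rw [Finset.sum_range_add, sum_splice_of_le le_rfl]
  simp only [splice_add]

variable [MeasurableSpace α]

lemma measurable_splice (n : ℕ) :
    Measurable fun p : (ℕ → α) × (ℕ → α) => splice n p.1 p.2 := by
  refine measurable_pi_lambda _ fun m => ?_
  by_cases h : m < n
  · simp only [splice, h, if_true]; fun_prop
  · simp only [splice, h, if_false]; fun_prop

/-- Splicing two independent i.i.d. sequences at a fixed position gives an i.i.d. sequence. -/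
lemma map_splice (ν : Measure α) [IsProbabilityMeasure ν] (n : ℕ) :
    ((Measure.infinitePi fun _ : ℕ => ν).prod (Measure.infinitePi fun _ : ℕ => ν)).map
      (fun p => splice n p.1 p.2) = Measure.infinitePi fun _ : ℕ => ν := by
  refine Measure.eq_infinitePi _ fun s t ht => ?_
  have hpre : (fun p : (ℕ → α) × (ℕ → α) => splice n p.1 p.2) ⁻¹' Set.pi s t =
      Set.pi (s.filter (· < n)) t ×ˢ
        Set.pi ((s.filter (¬ · < n)).image (· - n)) (fun m => t (n + m)) := by
    ext ⟨ξ, η⟩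
    simp only [Set.mem_preimage, Set.mem_pi, Finset.mem_coe, Set.mem_prod, Finset.mem_filter,
      Finset.mem_image]
    constructor
    · intro h
      refine ⟨fun m hm => splice_of_lt hm.2 ξ η ▸ h m hm.1, ?_⟩
      rintro _ ⟨m, ⟨hm, hn⟩, rfl⟩
      have := h m hm
      rw [splice, if_neg hn] at this
      rwa [Nat.add_sub_cancel' (not_lt.mp hn)]
    · rintro ⟨h₁, h₂⟩ m hm
      by_cases hn : m < n
      · rw [splice_of_lt hn]; exact h₁ m ⟨hm, hn⟩
      · rw [splice, if_neg hn]
        have := h₂ (m - n) ⟨m, ⟨hm, hn⟩, rfl⟩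
        rwa [Nat.add_sub_cancel' (not_lt.mp hn)] at this
  rw [Measure.map_apply (measurable_splice n)
    (MeasurableSet.pi s.countable_toSet fun i _ => ht i), hpre, Measure.prod_prod,
    Measure.infinitePi_pi _ fun i _ => ht i, Measure.infinitePi_pi _ fun i _ => ht _,
    Finset.prod_image, ← Finset.prod_filter_mul_prod_filter_not s (· < n)]
  · congr 1
    refine Finset.prod_congr rfl fun m hm => ?_
    rw [Nat.add_sub_cancel' (not_lt.mp (Finset.mem_filter.mp hm).2)]
  · intro a ha b hb hab
    simp only [Finset.coe_filter, Set.mem_ofPred_eq, not_lt] at ha hb hab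
    omega

/-- Splicing two independent i.i.d. sequences at an a.s. finite stopping time of the first one
gives an i.i.d. sequence. The stopping time equals `n` on the set `S n`. -/
lemma map_splice_stopping (ν : Measure α) [IsProbabilityMeasure ν] (S : ℕ → Set (ℕ → α))
    (hS : ∀ n, MeasurableSet (S n)) (hdisj : Pairwise (Function.onFun Disjoint S))
    (hmem : ∀ n ξ η, splice n ξ η ∈ S n ↔ ξ ∈ S n)
    (hfin : ∀ᵐ ξ ∂(Measure.infinitePi fun _ : ℕ => ν), ∃ n, ξ ∈ S n)
    (τ : (ℕ → α) → ℕ) (hτ : Measurable τ) (hτS : ∀ n, ∀ ξ ∈ S n, τ ξ = n) :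
    ((Measure.infinitePi fun _ : ℕ => ν).prod (Measure.infinitePi fun _ : ℕ => ν)).map
      (fun p => splice (τ p.1) p.1 p.2) = Measure.infinitePi fun _ : ℕ => ν := by
  set μ := Measure.infinitePi fun _ : ℕ => ν
  have hm : Measurable fun p : (ℕ → α) × (ℕ → α) => splice (τ p.1) p.1 p.2 := by
    have h : Measurable fun p : ((ℕ → α) × (ℕ → α)) × ℕ => splice p.2 p.1.1 p.1.2 :=
      measurable_from_prod_countable_left fun n => measurable_splice n
    exact h.comp (measurable_id.prodMk (hτ.comp measurable_fst))
  -- Both measures are decomposed over the value of the stopping time, which reduces the claim to a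
  -- fixed `n`.
  have split : ∀ {β : Type _} [MeasurableSpace β] (ρ : Measure β) (T : ℕ → Set β),
      (∀ n, MeasurableSet (T n)) → Pairwise (Function.onFun Disjoint T) →
      (∀ᵐ x ∂ρ, ∃ n, x ∈ T n) → ∀ A, MeasurableSet A → ρ A = ∑' n, ρ (A ∩ T n) := by
    intro β _ ρ T hT hd hc A hA
    rw [← measure_iUnion (fun a b hab => (hd hab).mono Set.inter_subset_right
      Set.inter_subset_right) (fun n => hA.inter (hT n)), ← Set.inter_iUnion]
    refine measure_congr ?_
    filter_upwards [hc] with x hx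
    refine propext ⟨fun h => ⟨h, Set.mem_iUnion.mpr hx⟩, fun h => h.1⟩
  ext A hA
  rw [Measure.map_apply hm hA, split μ S hS hdisj hfin A hA,
    split (μ.prod μ) (fun n => Prod.fst ⁻¹' S n) (fun n => measurable_fst (hS n))
      (fun a b hab => (hdisj hab).preimage _)
      (Measure.quasiMeasurePreserving_fst.ae hfin) _ (hm hA)]
  refine tsum_congr fun n => ?_
  -- Since `S n` depends on the first `n` terms only, `ξ ∈ S n` may be replaced by membership of the
  -- splice, and the fixed-time result applies to `A ∩ S n`.
  have := Measure.map_apply (μ := μ.prod μ) (measurable_splice n) (hA.inter (hS n))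
  rw [map_splice] at this
  rw [this]
  congr 1
  ext ⟨ξ, η⟩
  simp only [Set.mem_inter_iff, Set.mem_preimage, hmem]
  exact and_congr_left fun h => by rw [hτS n ξ h]

end Splice

/-! ### Combinatorics of the first emptying instant -/

section Hitting

/-- The instants at which a queue is empty, if it starts with `c` customers, one customer leaves
per time unit and `a m` customers arrive during the `m`-th time unit. -/
def emptyInstants (c : ℕ) (a : ℕ → ℕ) : Set ℕ := {n | c + ∑ m ∈ Finset.range n, a m = n}

/-- A path with downward steps of size at most one cannot pass below zero without visiting it. -/
lemma exists_mem_emptyInstants {c : ℕ} {a : ℕ → ℕ} {q : ℕ}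
    (h : c + ∑ m ∈ Finset.range q, a m ≤ q) : ∃ n ≤ q, n ∈ emptyInstants c a := by
  induction q with
  | zero => exact ⟨0, le_rfl, by simpa [emptyInstants] using h⟩
  | succ q ih =>
    by_cases hq : c + ∑ m ∈ Finset.range q, a m ≤ q
    · obtain ⟨n, hn, h'⟩ := ih hq
      exact ⟨n, hn.trans q.le_succ, h'⟩
    · refine ⟨q + 1, le_rfl, ?_⟩
      rw [Finset.sum_range_succ] at h
      simp only [emptyInstants, Set.mem_ofPred_eq, Finset.sum_range_succ]
      omega

lemma emptyInstants_congr {c n : ℕ} {a b : ℕ → ℕ} (h : ∀ m < n, a m = b m) :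
    n ∈ emptyInstants c a ↔ n ∈ emptyInstants c b := by
  simp only [emptyInstants, Set.mem_ofPred_eq]
  rw [Finset.sum_congr rfl fun m hm => h m (Finset.mem_range.mp hm)]

/-- The `c` other customers can be kept aside until the first one and all its descendants are gone,
because the order of service does not affect the queue length. -/
lemma isLeast_emptyInstants_splice {c n p : ℕ} {a b : ℕ → ℕ}
    (ha : IsLeast (emptyInstants 1 a) n) (hb : IsLeast (emptyInstants c b) p) :
    IsLeast (emptyInstants (c + 1) (splice n a b)) (n + p) := by
  have han : 1 + ∑ m ∈ Finset.range n, a m = n := ha.1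
  have hbp : c + ∑ m ∈ Finset.range p, b m = p := hb.1
  refine ⟨?_, fun q hq => ?_⟩
  · simp only [emptyInstants, Set.mem_ofPred_eq, sum_splice_add]
    omega
  · by_contra! hlt
    simp only [emptyInstants, Set.mem_ofPred_eq] at hq
    obtain hqn | ⟨r, rfl⟩ := (lt_or_ge q n).imp_right Nat.exists_eq_add_of_le
    · rw [sum_splice_of_le hqn.le] at hq
      -- Being empty at `q < n` despite the `c` extra customers would force the path of the single
      -- customer to hit zero by `q`, before its first emptying instant `n`.
      obtain ⟨r, hr, hr'⟩ := exists_mem_emptyInstants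
        (show 1 + ∑ m ∈ Finset.range q, a m ≤ q by omega)
      have := ha.2 hr'
      omega
    · rw [sum_splice_add] at hq
      have := hb.2 (show c + ∑ m ∈ Finset.range r, b m = r by omega)
      omega

/-- The first service removes the only customer, so `a 0` customers remain to be cleared; this is
the combinatorial core of the busy-period equation. -/
lemma isLeast_emptyInstants_one_splice {p : ℕ} {a b : ℕ → ℕ}
    (hb : IsLeast (emptyInstants (a 0) b) p) :
    IsLeast (emptyInstants 1 (splice 1 a b)) (1 + p) := by
  have hbp : a 0 + ∑ m ∈ Finset.range p, b m = p := hb.1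
  refine ⟨?_, fun q hq => ?_⟩
  · simp only [emptyInstants, Set.mem_ofPred_eq, sum_splice_add, Finset.sum_range_one]
    omega
  · simp only [emptyInstants, Set.mem_ofPred_eq] at hq
    obtain hqn | ⟨r, rfl⟩ := (lt_or_ge q 1).imp_right Nat.exists_eq_add_of_le
    · omega
    · rw [sum_splice_add, Finset.sum_range_one] at hq
      have := hb.2 (show a 0 + ∑ m ∈ Finset.range r, b m = r by omega)
      omega

end Hitting

/-! ### Measurability and additivity of the outcome of a visit -/

section Emptying

variable {N : ℕ}

lemma measurable_sInf_nat {α : Type*} [MeasurableSpace α] {p : α → ℕ → Prop}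
    (hp : ∀ n, MeasurableSet {x | p x n}) : Measurable fun x => sInf {n | p x n} := by
  classical
  refine measurable_to_countable' fun n => ?_
  -- The second set is there because `sInf ∅ = 0`.
  have h : (fun x => sInf {n | p x n}) ⁻¹' {n} =
      ({x | p x n} ∩ ⋂ m, ⋂ (_ : m < n), {x | p x m}ᶜ) ∪
        ({_x | n = 0} ∩ ⋂ m, {x | p x m}ᶜ) := by
    ext x
    simp only [Set.mem_preimage, Set.mem_singleton_iff, Set.mem_union, Set.mem_inter_iff,
      Set.mem_ofPred_eq, Set.mem_iInter, Set.mem_compl_iff]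
    constructor
    · rintro rfl
      by_cases hne : ∃ m, p x m
      · exact Or.inl ⟨Nat.sInf_mem hne, fun m hm => Nat.notMem_of_lt_sInf hm⟩
      · push Not at hne
        refine Or.inr ⟨?_, hne⟩
        rw [Nat.sInf_eq_zero]
        exact Or.inr (Set.eq_empty_iff_forall_notMem.mpr hne)
    · rintro (⟨h, h'⟩ | ⟨rfl, h⟩)
      · exact (IsLeast.csInf_eq ⟨h, fun m hm => not_lt.mp fun hlt => h' m hlt hm⟩)
      · rw [Nat.sInf_eq_zero]
        exact Or.inr (Set.eq_empty_iff_forall_notMem.mpr h)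
  rw [h]
  refine ((hp n).inter ?_).union (.inter (.const _) ?_)
  · exact .iInter fun m => .iInter fun _ => (hp m).compl
  · exact .iInter fun m => (hp m).compl

lemma measurableSet_mem_emptyInstants (i : Fin N) (c n : ℕ) :
    MeasurableSet {ξ : ℕ → ℝ≥0 × Pop N | n ∈ emptyInstants c fun m => (ξ m).2 i} := by
  have : Measurable fun ξ : ℕ → ℝ≥0 × Pop N => c + ∑ m ∈ Finset.range n, (ξ m).2 i := by
    fun_prop
  exact this (measurableSet_singleton n)

lemma measurable_emptyingTime (i : Fin N) (k : Pop N) : Measurable (PollingModel.emptyingTime i k) :=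
  measurable_sInf_nat (p := fun (ξ : ℕ → ℝ≥0 × Pop N) n => n ∈ emptyInstants (k i) fun m => (ξ m).2 i)
    fun n => measurableSet_mem_emptyInstants i (k i) n

lemma measurable_afterServices (i : Fin N) (k : Pop N) (n : ℕ) :
    Measurable fun ξ : ℕ → ℝ≥0 × Pop N => PollingModel.afterServices i k ξ n := by
  unfold PollingModel.afterServices
  refine .prodMk (by fun_prop) (measurable_pi_lambda _ fun j => ?_)
  have : Measurable fun ξ : ℕ → ℝ≥0 × Pop N => k j + ∑ m ∈ Finset.range n, (ξ m).2 j := by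
    fun_prop
  simpa using this.sub_const (Pi.single (M := fun _ => ℕ) i n j)

lemma measurable_afterEmptying (i : Fin N) (k : Pop N) :
    Measurable fun ξ => PollingModel.afterServices i k ξ (PollingModel.emptyingTime i k ξ) := by
  have h : Measurable fun p : (ℕ → ℝ≥0 × Pop N) × ℕ => PollingModel.afterServices i k p.1 p.2 :=
    measurable_from_prod_countable_left fun n => measurable_afterServices i k n
  exact h.comp (measurable_id.prodMk (measurable_emptyingTime i k))

/-- If there is nobody else in the system, then a visit that starts with `c` customers in `Q_i` and
ends after `n` services, when `Q_i` is empty, has this duration and final population. -/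
def clearance (i : Fin N) (n : ℕ) (ξ : ℕ → ℝ≥0 × Pop N) : ℝ≥0 × Pop N :=
  (∑ m ∈ Finset.range n, (ξ m).1, Function.update (∑ m ∈ Finset.range n, (ξ m).2) i 0)

/-- At an emptying instant coordinate `i` is exactly `n - n = 0`, and no other coordinate is
reduced; the customers elsewhere thus enter as a mere shift. -/
lemma afterServices_eq_clearance (i : Fin N) (k : Pop N) (ξ : ℕ → ℝ≥0 × Pop N) {n : ℕ}
    (hn : n ∈ emptyInstants (k i) fun m => (ξ m).2 i) :
    PollingModel.afterServices i k ξ n = (0, Function.update k i 0) + clearance i n ξ := by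
  have hn' : k i + ∑ m ∈ Finset.range n, (ξ m).2 i = n := hn
  refine Prod.ext (by simp [PollingModel.afterServices, clearance]) (funext fun j => ?_)
  by_cases hj : j = i
  · subst hj
    simp [PollingModel.afterServices, clearance, hn']
  · simp [PollingModel.afterServices, clearance, hj]

lemma clearance_splice (i : Fin N) (n p : ℕ) (ξ η : ℕ → ℝ≥0 × Pop N) :
    clearance i (n + p) (splice n ξ η) = clearance i n ξ + clearance i p η := by
  have h₁ := comp_splice Prod.fst n ξ η
  have h₂ := comp_splice Prod.snd n ξ η
  simp only [clearance, h₁, h₂, sum_splice_add, Prod.mk_add_mk, Prod.mk.injEq, true_and]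
  funext j
  by_cases hj : j = i
  · subst hj; simp
  · simp [hj]

end Emptying

/-! ### Convolution powers -/

section IidSum

variable {α : Type*} [MeasurableSpace α] [AddCommMonoid α]

/-- Law of the sum of `c` independent random variables with law `ρ`. -/
noncomputable def iidSum (ρ : Measure α) (c : ℕ) : Measure α :=
  (Measure.pi fun _ : Fin c => ρ).map fun y => ∑ m, y m

lemma iidSum_zero (ρ : Measure α) : iidSum ρ 0 = Measure.dirac 0 := by
  rw [iidSum, Measure.pi_of_empty, Measure.map_dirac']
  · simp
  · simp only [Finset.univ_eq_empty, Finset.sum_empty]; fun_prop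

lemma iidSum_succ [MeasurableAdd₂ α] (ρ : Measure α) [IsProbabilityMeasure ρ] (c : ℕ) :
    iidSum ρ (c + 1) = (ρ.prod (iidSum ρ c)).map fun p => p.1 + p.2 := by
  have hs : Measurable fun y : Fin c → α => ∑ m, y m := by fun_prop
  have h := (measurePreserving_piFinSuccAbove (fun _ : Fin (c + 1) => ρ) 0).map_eq
  have h' := Measure.map_prod_map ρ (Measure.pi fun _ : Fin c => ρ) measurable_id hs
  rw [Measure.map_id] at h'
  rw [iidSum, iidSum, h', Measure.map_map (by fun_prop) (by fun_prop),
    ← h, Measure.map_map (by fun_prop) (by fun_prop)]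
  congr 1
  funext y
  simp [Fin.sum_univ_succ, Fin.tail]

instance [MeasurableAdd₂ α] (ρ : Measure α) [IsProbabilityMeasure ρ] (c : ℕ) :
    IsProbabilityMeasure (iidSum ρ c) :=
  Measure.isProbabilityMeasure_map (by fun_prop)

lemma map_sum_infinitePi [MeasurableAdd₂ α] (ρ : Measure α) [IsProbabilityMeasure ρ] (c : ℕ) :
    (Measure.infinitePi fun _ : ℕ => ρ).map (fun ξ => ∑ m ∈ Finset.range c, ξ m) =
      iidSum ρ c := by
  have h := Measure.map_infinitePi_infinitePi_of_inj (P := fun _ : ℕ => ρ)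
    (Fin.val_injective (n := c))
  rw [Measure.infinitePi_eq_pi (μ := fun _ : Fin c => ρ)] at h
  rw [iidSum, ← h, Measure.map_map (by fun_prop) (by fun_prop)]
  congr 1
  funext ξ
  exact (Fin.sum_univ_eq_sum_range ξ c).symm

end IidSum

/-! ### The branching property as a shifted convolution power; gated service -/

section Branching

variable {N : ℕ}

lemma isBranching_iff (i : Fin N) (κ : Kernel (Pop N) (ℝ≥0 × Pop N)) :
    IsBranching i κ ↔ ∀ k : Pop N, κ k = (iidSum (oneCustomerLaw i κ) (k i)).map
      fun s => (0, Function.update k i 0) + s := by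
  refine forall_congr' fun k => ?_
  rw [iidSum, Measure.map_map (by fun_prop) (by fun_prop)]
  have : replaceAll i k = (fun s : ℝ≥0 × Pop N => (0, Function.update k i 0) + s) ∘
      fun y : Fin (k i) → ℝ≥0 × Pop N => ∑ m, y m := by
    funext y
    simp only [replaceAll, Function.comp]
    refine Prod.ext ?_ ?_
    · simp [Prod.fst_sum]
    · simp [Prod.snd_sum]
  rw [this]

variable (M : PollingModel N) (i : Fin N)

/-- The `k i` departures cancel exactly the `k i` initial customers, so the truncated subtraction
leaves all arrivals in place. -/
lemma gated_apply (k : Pop N) :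
    M.gated i k = (iidSum (M.serviceLaw i) (k i)).map
      fun s => (0, Function.update k i 0) + s := by
  change Measure.map _ _ = _
  rw [← map_sum_infinitePi, Measure.map_map (by fun_prop) (by fun_prop)]
  congr 1
  funext ξ
  refine Prod.ext ?_ (funext fun j => ?_)
  · simp [PollingModel.afterServices, Prod.fst_sum]
  · by_cases hj : j = i
    · subst hj
      simp [PollingModel.afterServices, Prod.snd_sum]
    · simp [PollingModel.afterServices, Prod.snd_sum, hj]

lemma iidSum_one {α : Type*} [MeasurableSpace α] [AddCommMonoid α] [MeasurableAdd₂ α]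
    (ρ : Measure α) [IsProbabilityMeasure ρ] : iidSum ρ 1 = ρ := by
  rw [iidSum_succ, iidSum_zero, Measure.prod_dirac, Measure.map_map (by fun_prop) (by fun_prop)]
  simp [Function.comp_def]

lemma oneCustomerLaw_gated : oneCustomerLaw i (M.gated i) = M.serviceLaw i := by
  have h : Function.update (Pi.single i 1 : Pop N) i 0 = 0 := by simp [Pi.single]
  rw [oneCustomerLaw, gated_apply, h, Pi.single_eq_same, iidSum_one]
  change Measure.map (fun s => 0 + s) _ = _
  simp

lemma isBranching_gated : IsBranching i (M.gated i) := by
  rw [isBranching_iff, oneCustomerLaw_gated]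
  exact gated_apply M i

lemma theta_gated (ω : ℝ) : theta i (M.gated i) ω = lst (M.service i) ω := by
  rw [theta, oneCustomerLaw_gated]
  congr 1
  exact Measure.fst_compProd (M.service i : Measure ℝ≥0) (arrivals M.rate)

end Branching

/-! ### A load below one empties the queue -/

section Stability

variable {N : ℕ}

lemma lintegral_natCast_poissonMeasure (r : ℝ≥0) : ∫⁻ n, (n : ℝ≥0∞) ∂poissonMeasure r = r := by
  have hs : HasSum (fun n : ℕ => Real.exp (-r) * (r : ℝ) ^ n / n.factorial * n) r := by
    have h := (hasSum_one_poissonMeasure r).mul_left (r : ℝ)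
    rw [mul_one] at h
    refine (hasSum_nat_add_iff' 1).mp ?_
    simp only [Finset.sum_range_one, Nat.cast_zero, mul_zero, sub_zero]
    have e : ∀ n : ℕ, Real.exp (-r) * (r : ℝ) ^ (n + 1) / (n + 1).factorial * ((n + 1 : ℕ) : ℝ) =
        r * (Real.exp (-r) * (r : ℝ) ^ n / n.factorial) := fun n => by
      rw [Nat.factorial_succ]
      push_cast
      field_simp
      ring
    simp_rw [e]
    exact h
  rw [poissonMeasure, lintegral_sum_measure]
  simp only [lintegral_smul_measure, lintegral_dirac, smul_eq_mul]
  have h := ENNReal.ofReal_tsum_of_nonneg (fun n => by positivity) hs.summable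
  rw [hs.tsum_eq, ENNReal.ofReal_coe_nnreal] at h
  rw [h]
  refine tsum_congr fun n => ?_
  rw [ENNReal.ofReal_mul (by positivity), ENNReal.ofReal_natCast]

lemma measurePreserving_eval_arrivals (rate : Fin N → ℝ≥0) (t : ℝ≥0) (i : Fin N) :
    MeasurePreserving (fun x : Pop N => x i) (arrivals rate t) (poissonMeasure (rate i * t)) :=
  measurePreserving_eval (fun j => poissonMeasure (rate j * t)) i

lemma lintegral_arrivals_serviceLaw (M : PollingModel N) (i : Fin N) :
    ∫⁻ y, (y.2 i : ℝ≥0∞) ∂M.serviceLaw i =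
      M.rate i * ∫⁻ t, (t : ℝ≥0∞) ∂(M.service i : Measure ℝ≥0) := by
  rw [PollingModel.serviceLaw, Measure.lintegral_compProd (by fun_prop),
    ← lintegral_const_mul _ (by fun_prop)]
  refine lintegral_congr fun t => ?_
  rw [(measurePreserving_eval_arrivals M.rate t i).lintegral_comp (f := fun n : ℕ => (n : ℝ≥0∞))
    (by fun_prop), lintegral_natCast_poissonMeasure, ENNReal.coe_mul]

open Filter Topology in
/-- If the mean number of arrivals per time unit is less than one, then the queue gets empty. -/
lemma ae_nonempty_emptyInstants {α : Type*} [MeasurableSpace α] (ν : Measure α)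
    [IsProbabilityMeasure ν] {f : α → ℕ} (hf : Measurable f)
    (hlt : ∫⁻ y, (f y : ℝ≥0∞) ∂ν < 1) (c : ℕ) :
    ∀ᵐ ξ ∂(Measure.infinitePi fun _ : ℕ => ν),
      (emptyInstants c fun m => f (ξ m)).Nonempty := by
  have hg : Measurable fun y => (f y : ℝ) := by fun_prop
  have hint : Integrable (fun y => (f y : ℝ)) ν := by
    refine ⟨hg.aestronglyMeasurable, ?_⟩
    simp only [HasFiniteIntegral, Real.enorm_natCast]
    exact hlt.trans ENNReal.one_lt_top
  have hmean : ∫ y, (f y : ℝ) ∂ν < 1 := by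
    rw [integral_eq_lintegral_of_nonneg_ae (ae_of_all _ fun y => Nat.cast_nonneg _)
      hg.aestronglyMeasurable]
    simp only [ENNReal.ofReal_natCast]
    simpa using (ENNReal.toReal_lt_toReal hlt.ne_top ENNReal.one_ne_top).mpr hlt
  have hev : ∀ m, MeasurePreserving (fun ξ : ℕ → α => ξ m) (Measure.infinitePi fun _ => ν) ν :=
    fun m => measurePreserving_eval_infinitePi (fun _ : ℕ => ν) m
  have hslln := strong_law_ae_real (μ := Measure.infinitePi fun _ : ℕ => ν)
    (fun m ξ => (f (ξ m) : ℝ)) ((hev 0).integrable_comp_of_integrable hint)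
    (fun m n hmn => (iIndepFun_infinitePi (P := fun _ : ℕ => ν) fun _ => hg).indepFun hmn)
    (fun m => ⟨(hg.comp (hev m).measurable).aemeasurable, (hg.comp (hev 0).measurable).aemeasurable, by
      have h : ∀ m, Measure.map (fun ξ : ℕ → α => (f (ξ m) : ℝ)) (Measure.infinitePi fun _ => ν) =
          ν.map fun y => (f y : ℝ) := fun m =>
        (Measure.map_map hg (hev m).measurable).symm.trans (by rw [(hev m).map_eq])
      rw [h, h]⟩)
  have h0 : ∫ ξ, (f (ξ 0) : ℝ) ∂(Measure.infinitePi fun _ : ℕ => ν) = ∫ y, (f y : ℝ) ∂ν := by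
    have h := integral_map (hev 0).measurable.aemeasurable (f := fun y => (f y : ℝ))
      (by rw [(hev 0).map_eq]; exact hg.aestronglyMeasurable)
    rw [(hev 0).map_eq] at h
    exact h.symm
  filter_upwards [hslln] with ξ hξ
  rw [h0] at hξ
  -- The initial `c` customers are negligible after division by `n`, so at some `n > 0` the initial
  -- customers and the arrivals together number fewer than `n`.
  have h := (tendsto_const_div_atTop_nhds_zero_nat (c : ℝ)).add hξ
  rw [zero_add] at h
  obtain ⟨n, hn, hn0⟩ := ((h.eventually_lt_const hmean).and (eventually_gt_atTop 0)).exists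
  have hle : c + ∑ m ∈ Finset.range n, f (ξ m) ≤ n := by
    rw [← add_div, div_lt_one (by exact_mod_cast hn0)] at hn
    exact_mod_cast hn.le
  obtain ⟨q, -, hq⟩ := exists_mem_emptyInstants hle
  exact ⟨q, hq⟩

end Stability

/-! ### Exhaustive service is of branching type -/

section Exhaustive

variable {N : ℕ} (M : PollingModel N) (i : Fin N)

/-- The first instant at which `Q_i` is empty, if it starts with `c` customers. -/
noncomputable def clearanceTime (c : ℕ) (ξ : ℕ → ℝ≥0 × Pop N) : ℕ :=
  sInf (emptyInstants c fun m => (ξ m).2 i)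

lemma measurable_clearanceTime (c : ℕ) : Measurable (clearanceTime (N := N) i c) :=
  measurable_sInf_nat (p := fun (ξ : ℕ → ℝ≥0 × Pop N) n =>
    n ∈ emptyInstants c fun m => (ξ m).2 i) fun n => measurableSet_mem_emptyInstants i c n

lemma isLeast_clearanceTime {i : Fin N} {c : ℕ} {ξ : ℕ → ℝ≥0 × Pop N}
    (h : (emptyInstants c fun m => (ξ m).2 i).Nonempty) :
    IsLeast (emptyInstants c fun m => (ξ m).2 i) (clearanceTime i c ξ) :=
  ⟨Nat.sInf_mem h, fun _ hm => Nat.sInf_le hm⟩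

lemma measurable_clearance (n : ℕ) : Measurable (clearance (N := N) i n) := by
  refine .prodMk (by fun_prop) (measurable_pi_lambda _ fun j => ?_)
  by_cases hj : j = i
  · subst hj; simp
  · simp only [Function.update_of_ne hj]; fun_prop

/-- Joint law of the duration of a visit to `Q_i` that starts with `c` customers in `Q_i` and ends
when `Q_i` is empty, and of the population that arrived to the other queues meanwhile. -/
noncomputable def clearanceLaw (c : ℕ) : Measure (ℝ≥0 × Pop N) :=
  (Measure.infinitePi fun _ : ℕ => M.serviceLaw i).map
    fun ξ => clearance i (clearanceTime i c ξ) ξ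

lemma measurable_clearance_clearanceTime (c : ℕ) :
    Measurable fun ξ : ℕ → ℝ≥0 × Pop N => clearance i (clearanceTime i c ξ) ξ := by
  have h : Measurable fun p : (ℕ → ℝ≥0 × Pop N) × ℕ => clearance i p.2 p.1 :=
    measurable_from_prod_countable_left fun n => measurable_clearance i n
  exact h.comp (measurable_id.prodMk (measurable_clearanceTime i c))

instance (c : ℕ) : IsProbabilityMeasure (clearanceLaw M i c) :=
  Measure.isProbabilityMeasure_map (measurable_clearance_clearanceTime i c).aemeasurable

/-- The load of `Q_i` is less than one. -/
noncomputable def IsStable : Prop :=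
  (M.rate i : ℝ≥0∞) * ∫⁻ t, (t : ℝ≥0∞) ∂(M.service i : Measure ℝ≥0) < 1

variable {M i}

lemma IsStable.ae_nonempty (h : IsStable M i) (c : ℕ) :
    ∀ᵐ ξ ∂(Measure.infinitePi fun _ : ℕ => M.serviceLaw i),
      (emptyInstants c fun m => (ξ m).2 i).Nonempty :=
  ae_nonempty_emptyInstants (M.serviceLaw i) (f := fun y => y.2 i) (by fun_prop)
    (by rw [lintegral_arrivals_serviceLaw]; exact h) c

/-- The default value `0` of the emptying time matters only where the queue never empties, which is
a null set under stability. -/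
lemma IsStable.exhaustive_apply (h : IsStable M i) (k : Pop N) :
    M.exhaustive i k = (clearanceLaw M i (k i)).map
      fun s => (0, Function.update k i 0) + s := by
  change Measure.map _ _ = _
  rw [clearanceLaw, Measure.map_map (by fun_prop) (measurable_clearance_clearanceTime i _)]
  refine Measure.map_congr ?_
  filter_upwards [h.ae_nonempty (k i)] with ξ hξ
  exact afterServices_eq_clearance i k ξ (isLeast_clearanceTime hξ).1

lemma IsStable.oneCustomerLaw_exhaustive (h : IsStable M i) :
    oneCustomerLaw i (M.exhaustive i) = clearanceLaw M i 1 := by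
  have h0 : Function.update (Pi.single i 1 : Pop N) i 0 = 0 := by simp [Pi.single]
  rw [oneCustomerLaw, h.exhaustive_apply, h0, Pi.single_eq_same]
  change Measure.map (fun s => 0 + s) _ = _
  simp

lemma clearanceLaw_zero : clearanceLaw M i 0 = Measure.dirac 0 := by
  have h : (fun ξ : ℕ → ℝ≥0 × Pop N => clearance i (clearanceTime i 0 ξ) ξ) = fun _ => 0 := by
    funext ξ
    have h0 : clearanceTime i 0 ξ = 0 :=
      IsLeast.csInf_eq ⟨by simp [emptyInstants], fun _ _ => Nat.zero_le _⟩
    simp [h0, clearance]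
  rw [clearanceLaw, h, Measure.map_const, measure_univ, one_smul]

/-- Splicing at the first instant at which a visit that starts with one customer ends. -/
lemma IsStable.map_splice_clearanceTime (h : IsStable M i) :
    ((Measure.infinitePi fun _ : ℕ => M.serviceLaw i).prod
      (Measure.infinitePi fun _ : ℕ => M.serviceLaw i)).map
      (fun p => splice (clearanceTime i 1 p.1) p.1 p.2) =
        Measure.infinitePi fun _ : ℕ => M.serviceLaw i := by
  refine map_splice_stopping (M.serviceLaw i)
    (fun n => {ξ | IsLeast (emptyInstants 1 fun m => (ξ m).2 i) n}) ?_ ?_ ?_ ?_ _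
    (measurable_clearanceTime i 1) fun n ξ hξ => hξ.csInf_eq
  · intro n
    have : {ξ : ℕ → ℝ≥0 × Pop N | IsLeast (emptyInstants 1 fun m => (ξ m).2 i) n} =
        {ξ | n ∈ emptyInstants 1 fun m => (ξ m).2 i} ∩ clearanceTime i 1 ⁻¹' {n} := by
      ext ξ
      exact ⟨fun hξ => ⟨hξ.1, hξ.csInf_eq⟩, fun ⟨h₁, h₂⟩ =>
        (Set.mem_singleton_iff.mp h₂) ▸ isLeast_clearanceTime ⟨n, h₁⟩⟩
    rw [this]
    exact (measurableSet_mem_emptyInstants i 1 n).inter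
      (measurable_clearanceTime i 1 (measurableSet_singleton n))
  · intro m n hmn
    exact Set.disjoint_left.mpr fun ξ hm hn => hmn (hm.unique hn)
  · intro n ξ η
    have hc : ∀ q ≤ n, (q ∈ emptyInstants 1 fun m => (splice n ξ η m).2 i) ↔
        q ∈ emptyInstants 1 fun m => (ξ m).2 i := fun q hq =>
      emptyInstants_congr fun m hm => by rw [splice_of_lt (hm.trans_le hq)]
    have hl : ∀ a b : ℕ → ℕ, (∀ q ≤ n, q ∈ emptyInstants 1 a ↔ q ∈ emptyInstants 1 b) →
        IsLeast (emptyInstants 1 a) n → IsLeast (emptyInstants 1 b) n := fun a b hab ha =>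
      ⟨(hab n le_rfl).mp ha.1, fun q hq => by
        by_contra! hlt
        exact absurd (ha.2 ((hab q hlt.le).mpr hq)) (not_le.mpr hlt)⟩
    exact ⟨hl _ _ hc, hl _ _ fun q hq => (hc q hq).symm⟩
  · filter_upwards [h.ae_nonempty 1] with ξ hξ
    exact ⟨_, isLeast_clearanceTime hξ⟩

/-- Strong Markov property at the end of the clearance started by one customer: what follows is an
independent clearance of the other `c`. -/
lemma IsStable.clearanceLaw_succ (h : IsStable M i) (c : ℕ) :
    clearanceLaw M i (c + 1) =
      ((clearanceLaw M i 1).prod (clearanceLaw M i c)).map fun p => p.1 + p.2 := by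
  have hm := measurable_clearance_clearanceTime (N := N) i
  have hsp : AEMeasurable (fun p : (ℕ → ℝ≥0 × Pop N) × (ℕ → ℝ≥0 × Pop N) =>
      splice (clearanceTime i 1 p.1) p.1 p.2)
      ((Measure.infinitePi fun _ : ℕ => M.serviceLaw i).prod
        (Measure.infinitePi fun _ : ℕ => M.serviceLaw i)) := by
    -- The pushforward along a map that is not a.e. measurable is zero by definition, whereas this
    -- one is a probability measure.
    refine AEMeasurable.of_map_ne_zero ?_
    rw [h.map_splice_clearanceTime]
    exact IsProbabilityMeasure.ne_zero _
  rw [clearanceLaw, ← h.map_splice_clearanceTime, AEMeasurable.map_map_of_aemeasurable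
    (by rw [h.map_splice_clearanceTime]; exact (hm _).aemeasurable) hsp, clearanceLaw,
    clearanceLaw, Measure.map_prod_map _ _ (hm 1) (hm c),
    Measure.map_map (by fun_prop) (by fun_prop)]
  refine Measure.map_congr ?_
  filter_upwards [Measure.quasiMeasurePreserving_fst.ae (h.ae_nonempty 1),
    Measure.quasiMeasurePreserving_snd.ae (h.ae_nonempty c)] with p h₁ h₂
  have hl := isLeast_emptyInstants_splice (isLeast_clearanceTime h₁) (isLeast_clearanceTime h₂)
  rw [← comp_splice (fun y : ℝ≥0 × Pop N => y.2 i)] at hl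
  have : clearanceTime i (c + 1) (splice (clearanceTime i 1 p.1) p.1 p.2) = _ := hl.csInf_eq
  simp only [Function.comp, Prod.map, this, clearance_splice]

lemma IsStable.clearanceLaw_eq_iidSum (h : IsStable M i) (c : ℕ) :
    clearanceLaw M i c = iidSum (clearanceLaw M i 1) c := by
  induction c with
  | zero => rw [clearanceLaw_zero, iidSum_zero]
  | succ c ih => rw [h.clearanceLaw_succ, iidSum_succ, ih]

lemma IsStable.isBranching_exhaustive (h : IsStable M i) : IsBranching i (M.exhaustive i) := by
  rw [isBranching_iff, h.oneCustomerLaw_exhaustive]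
  intro k
  rw [h.exhaustive_apply, h.clearanceLaw_eq_iidSum]

end Exhaustive

/-! ### Laplace-Stieltjes transforms of visit times -/

section Transform

variable {N : ℕ}

lemma measurable_exp_neg_mul {α : Type*} [MeasurableSpace α] {f : α → ℝ≥0} (hf : Measurable f)
    (ω : ℝ) : Measurable fun y => Real.exp (-(ω * (f y : ℝ))) := by
  fun_prop

lemma integrable_exp_neg_mul {α : Type*} [MeasurableSpace α] {μ : Measure α} [IsFiniteMeasure μ]
    {f : α → ℝ≥0} (hf : Measurable f) {ω : ℝ} (hω : 0 ≤ ω) :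
    Integrable (fun y => Real.exp (-(ω * (f y : ℝ)))) μ := by
  refine .of_bound (measurable_exp_neg_mul hf ω).aestronglyMeasurable 1 (ae_of_all _ fun y => ?_)
  rw [Real.norm_eq_abs, Real.abs_exp, Real.exp_le_one_iff]
  exact neg_nonpos.mpr (mul_nonneg hω (NNReal.coe_nonneg _))

lemma lst_map {α : Type*} [MeasurableSpace α] (μ : Measure α) {f : α → ℝ≥0} (hf : Measurable f)
    (ω : ℝ) : lst (μ.map f) ω = ∫ y, Real.exp (-(ω * (f y : ℝ))) ∂μ :=
  integral_map hf.aemeasurable (by fun_prop : Measurable _).aestronglyMeasurable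

lemma lst_pos (μ : Measure ℝ≥0) [IsProbabilityMeasure μ] {ω : ℝ} (hω : 0 ≤ ω) : 0 < lst μ ω :=
  integral_exp_pos (integrable_exp_neg_mul measurable_id hω)

lemma lst_le_one (μ : Measure ℝ≥0) [IsProbabilityMeasure μ] {ω : ℝ} (hω : 0 ≤ ω) :
    lst μ ω ≤ 1 := by
  have h := integral_mono (μ := μ) (integrable_exp_neg_mul measurable_id hω)
    (integrable_const (1 : ℝ)) fun y => Real.exp_le_one_iff.mpr
      (neg_nonpos.mpr (mul_nonneg hω (NNReal.coe_nonneg _)))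
  rwa [integral_const, probReal_univ, one_smul] at h

lemma theta_eq (i : Fin N) (κ : Kernel (Pop N) (ℝ≥0 × Pop N)) (ω : ℝ) :
    theta i κ ω = ∫ y, Real.exp (-(ω * (y.1 : ℝ))) ∂oneCustomerLaw i κ :=
  lst_map _ measurable_fst ω

instance (i : Fin N) (κ : Kernel (Pop N) (ℝ≥0 × Pop N)) [IsMarkovKernel κ] :
    IsProbabilityMeasure (oneCustomerLaw i κ) := by
  unfold oneCustomerLaw; infer_instance

/-- The LST of a sum of i.i.d. durations. -/
lemma integral_exp_iidSum (ρ : Measure (ℝ≥0 × Pop N)) [IsProbabilityMeasure ρ] (c : ℕ) (ω : ℝ) :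
    ∫ s, Real.exp (-(ω * (s.1 : ℝ))) ∂iidSum ρ c =
      (∫ y, Real.exp (-(ω * (y.1 : ℝ))) ∂ρ) ^ c := by
  rw [iidSum, integral_map (by fun_prop) (by fun_prop : Measurable _).aestronglyMeasurable]
  have h := integral_fintype_prod_eq_pow (ι := Fin c) (μ := ρ)
    fun y : ℝ≥0 × Pop N => Real.exp (-(ω * (y.1 : ℝ)))
  rw [Fintype.card_fin] at h
  rw [← h]
  refine integral_congr_ae (ae_of_all _ fun y => ?_)
  simp only [Prod.fst_sum, NNReal.coe_sum, Finset.mul_sum, ← Finset.sum_neg_distrib, Real.exp_sum]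

/-- The LST of the visit time, given the queue lengths at the start of the service. -/
lemma IsBranching.integral_exp {i : Fin N} {κ : Kernel (Pop N) (ℝ≥0 × Pop N)} [IsMarkovKernel κ]
    (h : IsBranching i κ) (k : Pop N) (ω : ℝ) :
    ∫ y, Real.exp (-(ω * (y.1 : ℝ))) ∂κ k = theta i κ ω ^ k i := by
  rw [(isBranching_iff i κ).mp h k, integral_map (by fun_prop)
    (by fun_prop : Measurable _).aestronglyMeasurable, theta_eq, ← integral_exp_iidSum]
  simp

lemma theta_mem_Ioc (i : Fin N) (κ : Kernel (Pop N) (ℝ≥0 × Pop N)) [IsMarkovKernel κ] {ω : ℝ}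
    (hω : 0 ≤ ω) : theta i κ ω ∈ Set.Ioc (0 : ℝ) 1 := by
  have : IsProbabilityMeasure ((oneCustomerLaw i κ).map Prod.fst) :=
    Measure.isProbabilityMeasure_map (by fun_prop)
  exact ⟨lst_pos _ hω, lst_le_one _ hω⟩

lemma lst_visit {i : Fin N} {κ : Kernel (Pop N) (ℝ≥0 × Pop N)} [IsMarkovKernel κ]
    (h : IsBranching i κ) (μ : Measure (Pop N)) [IsProbabilityMeasure μ] {ω : ℝ} (hω : 0 ≤ ω) :
    lst ((κ ∘ₘ μ).map Prod.fst) ω = pgf μ (Function.update (fun _ => 1) i (theta i κ ω)) := by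
  rw [lst_map _ measurable_fst, ← Measure.snd_compProd, Measure.snd,
    integral_map (by fun_prop) (by fun_prop : Measurable _).aestronglyMeasurable,
    Measure.integral_compProd (integrable_exp_neg_mul (by fun_prop) hω), pgf]
  refine integral_congr_ae (ae_of_all _ fun k => ?_)
  simp only [h.integral_exp]
  rw [Finset.prod_eq_single i (fun j _ hj => by simp [hj]) (by simp)]
  simp

end Transform

/-! ### The evolution of the system preserves probability -/

section Evolution

variable {N : ℕ}

instance (q : Fin N → I) : IsMarkovKernel (reneging q) :=
  ⟨fun k => by
    change IsProbabilityMeasure (Measure.pi fun j => binomial (k j) (q j))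
    infer_instance⟩

variable (M : PollingModel N) (i : Fin N)

instance : IsMarkovKernel (M.visit i) := M.visit_markov i

instance : IsMarkovKernel (M.switchStep i) :=
  ⟨fun k => by
    change IsProbabilityMeasure
      (((arrivals M.rate ∘ₘ (M.switchover i : Measure ℝ≥0))).map fun a => k + a)
    exact Measure.isProbabilityMeasure_map (by fun_prop)⟩

instance : IsMarkovKernel (M.step i) := by
  have : IsMarkovKernel ((M.visit i).map Prod.snd) := Kernel.IsMarkovKernel.map _ measurable_snd
  unfold PollingModel.step
  infer_instance

instance [NeZero N] (μ₀ : Measure (Pop N)) [IsProbabilityMeasure μ₀] (m : ℕ) :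
    IsProbabilityMeasure (M.lawStart μ₀ m) := by
  induction m with
  | zero => assumption
  | succ m ih => rw [PollingModel.lawStart]; infer_instance

instance [NeZero N] (μ₀ : Measure (Pop N)) [IsProbabilityMeasure μ₀] (n : ℕ) :
    IsProbabilityMeasure (M.lawVb μ₀ n i) := by
  unfold PollingModel.lawVb PollingModel.lawVa; infer_instance

end Evolution

/-! ### The busy-period equation and uniqueness of its root -/

section BusyPeriod

variable {N : ℕ} {M : PollingModel N} {i : Fin N}

instance : IsMarkovKernel (M.exhaustive i) :=
  ⟨fun k => by
    change IsProbabilityMeasure (Measure.map _ _)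
    exact Measure.isProbabilityMeasure_map (measurable_afterEmptying i k).aemeasurable⟩

lemma integral_pow_poissonMeasure (r : ℝ≥0) (z : ℝ) :
    ∫ n, z ^ n ∂poissonMeasure r = Real.exp (-(r * (1 - z))) := by
  rw [integral_poissonMeasure]
  have h := (NormedSpace.expSeries_div_hasSum_exp ((r : ℝ) * z)).mul_left (Real.exp (-r))
  rw [← Real.exp_eq_exp_ℝ, ← Real.exp_add] at h
  rw [show -((r : ℝ) * (1 - z)) = -r + r * z by ring, ← h.tsum_eq]
  refine tsum_congr fun n => ?_
  rw [mul_pow, smul_eq_mul]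
  ring

/-- Given a service time `t`, the arrivals at `Q_i` contribute `exp(-λ_i t (1 - z))`, which merges
with `exp(-ω t)`. -/
lemma integral_exp_mul_pow_serviceLaw {ω z : ℝ} (hω : 0 ≤ ω) (hz : z ∈ Set.Ioc (0 : ℝ) 1) :
    ∫ y, Real.exp (-(ω * (y.1 : ℝ))) * z ^ y.2 i ∂M.serviceLaw i =
      lst (M.service i) (ω + M.rate i * (1 - z)) := by
  rw [PollingModel.serviceLaw, Measure.integral_compProd, lst]
  · refine integral_congr_ae (ae_of_all _ fun t => ?_)
    simp only
    have ht : ∫ x, z ^ x i ∂arrivals M.rate t = _ :=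
      (measurePreserving_eval_arrivals M.rate t i).hasLaw.integral_comp
        (f := fun n : ℕ => z ^ n) (by fun_prop)
    rw [integral_const_mul, ht, integral_pow_poissonMeasure, ← Real.exp_add]
    congr 1
    push_cast
    ring
  · refine (integrable_exp_neg_mul measurable_fst hω).mul_bdd (c := 1)
      (by fun_prop : Measurable _).aestronglyMeasurable (ae_of_all _ fun y => ?_)
    rw [Real.norm_eq_abs, abs_of_nonneg (pow_nonneg hz.1.le _)]
    exact pow_le_one₀ hz.1.le hz.2

/-- The busy-period equation. -/
lemma IsStable.theta_exhaustive (h : IsStable M i) {ω : ℝ} (hω : 0 ≤ ω) :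
    theta i (M.exhaustive i) ω = lst (M.service i)
      (ω + M.rate i * (1 - theta i (M.exhaustive i) ω)) := by
  have hm := measurable_clearance_clearanceTime (N := N) i
  have hθ := theta_mem_Ioc i (M.exhaustive i) hω
  rw [← integral_exp_mul_pow_serviceLaw hω hθ]
  set θ := theta i (M.exhaustive i) ω with hθdef
  have hpow : ∀ c, ∫ η, Real.exp (-(ω * ((clearance i (clearanceTime i c η) η).1 : ℝ)))
      ∂(Measure.infinitePi fun _ : ℕ => M.serviceLaw i) = θ ^ c := fun c => by
    rw [hθdef, theta_eq, h.oneCustomerLaw_exhaustive, ← integral_exp_iidSum,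
      ← h.clearanceLaw_eq_iidSum, clearanceLaw, integral_map (hm c).aemeasurable
      (by fun_prop : Measurable _).aestronglyMeasurable]
  have hfirst := hpow 1
  -- Regeneration after the first service: `p.1 0` is that service and `p.2` is the independent
  -- future.
  rw [← map_splice (M.serviceLaw i) 1, integral_map (measurable_splice 1).aemeasurable
    (measurable_exp_neg_mul (hm 1).fst ω).aestronglyMeasurable, pow_one] at hfirst
  refine hfirst.symm.trans ?_
  have hae : ∀ᵐ p ∂((Measure.infinitePi fun _ : ℕ => M.serviceLaw i).prod
      (Measure.infinitePi fun _ : ℕ => M.serviceLaw i)),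
      clearance i (clearanceTime i 1 (splice 1 p.1 p.2)) (splice 1 p.1 p.2) =
        clearance i 1 p.1 + clearance i (clearanceTime i ((p.1 0).2 i) p.2) p.2 := by
    filter_upwards [Measure.quasiMeasurePreserving_snd.ae
      (ae_all_iff.mpr fun c => h.ae_nonempty c)] with p hp
    have hl := isLeast_emptyInstants_one_splice (a := fun m => (p.1 m).2 i)
      (isLeast_clearanceTime (hp ((p.1 0).2 i)))
    rw [← comp_splice (fun y : ℝ≥0 × Pop N => y.2 i)] at hl
    have : clearanceTime i 1 (splice 1 p.1 p.2) = _ := hl.csInf_eq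
    rw [this, clearance_splice]
  have hsplit : ∀ᵐ p ∂((Measure.infinitePi fun _ : ℕ => M.serviceLaw i).prod
      (Measure.infinitePi fun _ : ℕ => M.serviceLaw i)),
      Real.exp (-(ω * ((clearance i (clearanceTime i 1 (splice 1 p.1 p.2))
        (splice 1 p.1 p.2)).1 : ℝ))) = Real.exp (-(ω * ((p.1 0).1 : ℝ))) *
        Real.exp (-(ω * ((clearance i (clearanceTime i ((p.1 0).2 i) p.2) p.2).1 : ℝ))) := by
    filter_upwards [hae] with p hp
    rw [hp, ← Real.exp_add]
    congr 1
    simp only [clearance, Finset.sum_range_one, Prod.mk_add_mk, NNReal.coe_add]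
    ring
  have hmeas : Measurable fun p : (ℕ → ℝ≥0 × Pop N) × (ℕ → ℝ≥0 × Pop N) =>
      clearance i (clearanceTime i ((p.1 0).2 i) p.2) p.2 := by
    have : Measurable fun q : ℕ × (ℕ → ℝ≥0 × Pop N) =>
        clearance i (clearanceTime i q.1 q.2) q.2 := measurable_from_prod_countable_right hm
    exact this.comp ((by fun_prop : Measurable fun p : (ℕ → ℝ≥0 × Pop N) × (ℕ → ℝ≥0 × Pop N) =>
      (p.1 0).2 i).prodMk measurable_snd)
  rw [integral_congr_ae hsplit, integral_prod _ ((integrable_exp_neg_mul (by fun_prop) hω).mul_bdd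
    (c := 1) (measurable_exp_neg_mul hmeas.fst ω).aestronglyMeasurable (ae_of_all _ fun p => ?_))]
  -- With `p.1` fixed, integrating out `p.2` clears the customers that arrived during the first
  -- service, giving `θ` to the power of their number.
  · simp only [integral_const_mul, hpow]
    have he := (measurePreserving_eval_infinitePi (fun _ : ℕ => M.serviceLaw i) 0).hasLaw
    exact he.integral_comp (f := fun y : ℝ≥0 × Pop N => Real.exp (-(ω * (y.1 : ℝ))) * θ ^ y.2 i)
      (by fun_prop : Measurable _).aestronglyMeasurable
  · rw [Real.norm_eq_abs, Real.abs_exp, Real.exp_le_one_iff]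
    exact neg_nonpos.mpr (mul_nonneg hω (NNReal.coe_nonneg _))

lemma exp_neg_sub_exp_neg_le {a b : ℝ} (ha : 0 ≤ a) :
    Real.exp (-a) - Real.exp (-b) ≤ |b - a| := by
  have h := Real.add_one_le_exp (a - b)
  have hle : Real.exp (-a) ≤ 1 := Real.exp_le_one_iff.mpr (by linarith)
  have he : Real.exp (-b) = Real.exp (-a) * Real.exp (a - b) := by
    rw [← Real.exp_add]; congr 1; ring
  have hp := Real.exp_pos (-a)
  rcases le_total a b with hab | hab
  · rw [abs_of_nonneg (by linarith), he]
    nlinarith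
  · have : Real.exp (-a) ≤ Real.exp (-b) := Real.exp_le_exp.mpr (by linarith)
    linarith [abs_nonneg (b - a)]

/-- The busy-period equation has at most one root in `(0, 1]`. -/
lemma IsStable.eq_of_lst_eq (h : IsStable M i) {ω x y : ℝ} (hω : 0 ≤ ω)
    (hx : x ∈ Set.Ioc (0 : ℝ) 1) (hy : y ∈ Set.Ioc (0 : ℝ) 1)
    (hx' : x = lst (M.service i) (ω + M.rate i * (1 - x)))
    (hy' : y = lst (M.service i) (ω + M.rate i * (1 - y))) : x = y := by
  wlog hlt : y < x generalizing x y
  · rcases (not_lt.mp hlt).eq_or_lt with he | he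
    · exact he
    · exact (this hy hx hy' hx' he).symm
  exfalso
  have hpos : ∀ z ∈ Set.Ioc (0 : ℝ) 1, 0 ≤ ω + M.rate i * (1 - z) := fun z hz =>
    add_nonneg hω (mul_nonneg (M.rate i).2 (by linarith [hz.2]))
  have hL : ∫⁻ t : ℝ≥0, ENNReal.ofReal ((M.rate i : ℝ) * (t : ℝ))
      ∂(M.service i : Measure ℝ≥0) < 1 := by
    have hof : ∀ t : ℝ≥0, ENNReal.ofReal ((M.rate i : ℝ) * (t : ℝ)) = (M.rate i : ℝ≥0∞) * t :=
      fun t => by rw [← NNReal.coe_mul, ENNReal.ofReal_coe_nnreal, ENNReal.coe_mul]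
    simp_rw [hof]
    rw [lintegral_const_mul _ (by fun_prop)]
    exact h
  have hnn : 0 ≤ᵐ[(M.service i : Measure ℝ≥0)] fun t : ℝ≥0 => (M.rate i : ℝ) * (t : ℝ) :=
    ae_of_all _ fun t => mul_nonneg (M.rate i).2 t.2
  have hsm : AEStronglyMeasurable (fun t : ℝ≥0 => (M.rate i : ℝ) * (t : ℝ))
      (M.service i : Measure ℝ≥0) := (by fun_prop : Measurable _).aestronglyMeasurable
  -- Integrability holds for the product `λ_i t`, not necessarily for `t`: the mean service time may
  -- be infinite when the rate is zero.
  have hint := (lintegral_ofReal_ne_top_iff_integrable hsm hnn).mp hL.ne_top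
  have hmean : ∫ t : ℝ≥0, (M.rate i : ℝ) * (t : ℝ) ∂(M.service i : Measure ℝ≥0) < 1 := by
    rw [integral_eq_lintegral_of_nonneg_ae hnn hsm]
    simpa using (ENNReal.toReal_lt_toReal hL.ne_top ENNReal.one_ne_top).mpr hL
  have hexp : ∀ z ∈ Set.Ioc (0 : ℝ) 1, Integrable
      (fun t : ℝ≥0 => Real.exp (-((ω + M.rate i * (1 - z)) * (t : ℝ))))
      (M.service i : Measure ℝ≥0) := fun z hz => integrable_exp_neg_mul measurable_id (hpos z hz)
  -- The integrands differ by at most the difference of their exponents, so two distinct roots would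
  -- satisfy `x - y ≤ (x - y) λ_i E[B_i] < x - y`.
  have hle : x - y ≤ ∫ t : ℝ≥0, (x - y) * ((M.rate i : ℝ) * (t : ℝ))
      ∂(M.service i : Measure ℝ≥0) := by
    conv_lhs => rw [hx', hy']
    rw [lst, lst, ← integral_sub (hexp x hx) (hexp y hy)]
    refine integral_mono ((hexp x hx).sub (hexp y hy)) (hint.const_mul _) fun t => ?_
    refine (exp_neg_sub_exp_neg_le (mul_nonneg (hpos x hx) (NNReal.coe_nonneg t))).trans_eq ?_
    have he : (ω + M.rate i * (1 - y)) * (t : ℝ) - (ω + M.rate i * (1 - x)) * (t : ℝ) =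
        (x - y) * ((M.rate i : ℝ) * (t : ℝ)) := by ring
    rw [he]
    exact abs_of_nonneg (mul_nonneg (by linarith) (mul_nonneg (M.rate i).2 (NNReal.coe_nonneg t)))
  rw [integral_const_mul] at hle
  nlinarith

end BusyPeriod

end Polling

/-- The law `μ₀` of the queue lengths at the beginning of the first cycle is arbitrary; taking it
invariant gives the statement for the stationary system. -/
theorem mainTheorem4 {N : ℕ} [NeZero N] (M : Polling.PollingModel N)
    (μ₀ : Measure (Polling.Pop N)) [IsProbabilityMeasure μ₀] (i : Fin N) :
    -- the LST of the visit time for any branching-type discipline at `Q_i`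
    (Polling.IsBranching i (M.visit i) →
      ∀ (n : ℕ) (ω : ℝ), 0 ≤ ω →
        Polling.lst (M.lawVisitTime μ₀ n i) ω =
          Polling.pgf (M.lawVb μ₀ n i)
            (Function.update (fun _ => 1) i (Polling.theta i (M.visit i) ω))) ∧
    -- gated service is of branching type, with `θ_i = β_i`
    (Polling.IsBranching i (M.gated i) ∧
      ∀ ω : ℝ, 0 ≤ ω → Polling.theta i (M.gated i) ω = Polling.lst (M.service i) ω) ∧
    -- exhaustive service is of branching type, and `θ_i (ω)` is the root `π_i (ω)` in `(0, 1]` of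
    -- the busy-period equation
    ((M.rate i : ℝ≥0∞) * ∫⁻ t, (t : ℝ≥0∞) ∂(M.service i : Measure ℝ≥0) < 1 →
      Polling.IsBranching i (M.exhaustive i) ∧
      ∀ ω : ℝ, 0 ≤ ω → ∀ x : ℝ,
        (x = Polling.theta i (M.exhaustive i) ω ↔
          x ∈ Set.Ioc (0 : ℝ) 1 ∧
            x = Polling.lst (M.service i) (ω + M.rate i * (1 - x)))) := by
  refine ⟨fun h n ω hω => Polling.lst_visit h _ hω,
    ⟨Polling.isBranching_gated M i, fun ω _ => Polling.theta_gated M i ω⟩, fun h => ?_⟩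
  have hs : Polling.IsStable M i := h
  refine ⟨hs.isBranching_exhaustive, fun ω hω x => ⟨?_, fun hx => ?_⟩⟩
  · rintro rfl
    exact ⟨Polling.theta_mem_Ioc i _ hω, hs.theta_exhaustive hω⟩
  · exact hs.eq_of_lst_eq hω hx.1 (Polling.theta_mem_Ioc i _ hω) hx.2 (hs.theta_exhaustive hω)
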